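/- Let $\Gamma$ be a countable group with a homomorphism $[\,\cdot\,]\colon\Gamma\to\mathbb Z$, let $a\neq b$ in $\Gamma$ satisfy $[a]=[b]=1$, let $M\ge 3$ be an integer, and put $f=M-a-b\in\mathbb Z\Gamma$ and $f^*=M-a^{-1}-b^{-1}$. Write $\mathbb T=\mathbb R/\mathbb Z$, and let $X_f\subset\mathbb T^\Gamma$ be the compact abelian group of all $x$ such that $\langle x,g\rangle=\sum_{s\in\Gamma}g_sx_s=0$ for every $g$ in the left ideal $\mathbb Z\Gamma f$; that is, $X_f$ is the Pontryagin dual of $\mathbb Z\Gamma/\mathbb Z\Gamma f$. Let $\Gamma$ act on $X_f$ by the automorphisms $(\alpha_f^s x)_t=x_{s^{-1}t}$, and let $\mu_f$ be normalized Haar measure on $X_f$. Let $Y=\{0,1,\dots,M-1\}^\Gamma$ carry the shift action $(\sigma^s d)_t=d_{s^{-1}t}$ and the product measure $\nu$ of the uniform probability measures on $\{0,1,\dots,M-1\}$. Then $f^*$ has a (two-sided convolution) inverse $w$ in $\ell^1(\Gamma,\mathbb R)$. The homoclinic map $\phi(d)_s=\sum_{t\in\Gamma}d_t\,w_{t^{-1}s}\pmod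 1$ takes $Y$ into $X_f$, and it is a measurable isomorphism from the Bernoulli action $(Y,\sigma,\nu)$ to the principal algebraic action $(X_f,\alpha_f,\mu_f)$: it is measurable, it satisfies $\phi_*\nu=\mu_f$ and, for each $s\in\Gamma$, $\phi\circ\sigma^s=\alpha_f^s\circ\phi$ $\nu$-almost everywhere, and there is a measurable $\psi\colon X_f\to Y$ with $\psi_*\mu_f=\nu$, $\psi\circ\phi=\mathrm{id}$ $\nu$-almost everywhere and $\phi\circ\psi=\mathrm{id}$ $\mu_f$-almost everywhere. -/

import Mathlib

open MeasureTheory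

noncomputable section

namespace PrincipalAction

set_option linter.unusedSectionVars false

variable {Γ : Type*} [Group Γ]

/-- The left shift action of `Γ` on `Γ → A`: `(σ^s x)_t = x_{s⁻¹ t}`. -/
def shift (A : Type*) : Γ →* Equiv.Perm (Γ → A) where
  toFun s :=
    { toFun := fun x t => x (s⁻¹ * t)
      invFun := fun x t => x (s * t)
      left_inv := fun x => by funext t; simp
      right_inv := fun x => by funext t; simp }
  map_one' := by ext x t; simp
  map_mul' s u := by ext x t; simp [mul_assoc]

/-- The dual pairing `⟨x, g⟩ = ∑_s g_s x_s` between `𝕋^Γ` and the integral group ring `ℤΓ`. -/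
def pairing (x : Γ → UnitAddCircle) (g : MonoidAlgebra ℤ Γ) : UnitAddCircle :=
  g.coeff.sum fun s n => n • x s

theorem pairing_add (x : Γ → UnitAddCircle) (g h : MonoidAlgebra ℤ Γ) :
    pairing x (g + h) = pairing x g + pairing x h := by
  classical
  unfold pairing
  rw [MonoidAlgebra.coeff_add]
  exact Finsupp.sum_add_index' (by simp) (by intros; rw [add_smul])

theorem pairing_single (x : Γ → UnitAddCircle) (s : Γ) (n : ℤ) :
    pairing x (MonoidAlgebra.single s n) = n • x s := by
  unfold pairing
  exact Finsupp.sum_single_index (by simp)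

/-- Pairing is compatible with the action of `Γ` on `ℤΓ` by left multiplication. -/
theorem pairing_shift (s : Γ) (x : Γ → UnitAddCircle) (g : MonoidAlgebra ℤ Γ) :
    pairing (shift UnitAddCircle s x) g = pairing x (MonoidAlgebra.single s⁻¹ 1 * g) := by
  induction g using MonoidAlgebra.induction_linear with
  | zero => simp [pairing]
  | add g h hg hh => rw [mul_add, pairing_add, pairing_add, hg, hh]
  | single t n => rw [MonoidAlgebra.single_mul_single, pairing_single, pairing_single]; simp [shift]

/-- The group `X_f`: the annihilator in `𝕋^Γ` of the left ideal `ℤΓ f`, i.e. the Pontryagin dual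
of `ℤΓ / ℤΓ f`. (`Ideal` means left ideal.) -/
def principalGroup (f : MonoidAlgebra ℤ Γ) : AddSubgroup (Γ → UnitAddCircle) where
  carrier := {x | ∀ g ∈ Ideal.span {f}, pairing x g = 0}
  zero_mem' := fun g _ => by simp [pairing]
  add_mem' := fun {x y} hx hy g hg => by
    have h : pairing (x + y) g = pairing x g + pairing y g := by
      simp [pairing, Finsupp.sum_add]
    rw [h, hx g hg, hy g hg, add_zero]
  neg_mem' := fun {x} hx g hg => by
    have h : pairing (-x) g = - pairing x g := by
      simp [pairing, Finsupp.sum]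
    rw [h, hx g hg, neg_zero]

/-- The concrete description of `X_f`: `x ∈ X_f` iff `∑_s f_s x_{ts} = 0` for every `t`. -/
theorem mem_principalGroup_iff (f : MonoidAlgebra ℤ Γ) (x : Γ → UnitAddCircle) :
    x ∈ principalGroup f ↔ ∀ t : Γ, (f.coeff.sum fun s n => n • x (t * s)) = 0 := by
  have key : ∀ t : Γ, (f.coeff.sum fun s n => n • x (t * s))
      = pairing x (MonoidAlgebra.single t 1 * f) := by
    intro t
    have h := pairing_shift t⁻¹ x f
    rw [inv_inv] at h
    rw [← h]
    simp [pairing, shift]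
  constructor
  · intro hx t
    rw [key]
    exact hx _ (Ideal.mul_mem_left _ _ (Ideal.subset_span rfl))
  · intro hx g hg
    obtain ⟨h, rfl⟩ := Ideal.mem_span_singleton'.1 hg
    induction h using MonoidAlgebra.induction_linear with
    | zero => simp [pairing]
    | add g h ihg ihh =>
      rw [add_mul, pairing_add, ihg (Ideal.mul_mem_left _ _ (Ideal.subset_span rfl)),
        ihh (Ideal.mul_mem_left _ _ (Ideal.subset_span rfl)), add_zero]
    | single t n =>
      have e : (MonoidAlgebra.single t n : MonoidAlgebra ℤ Γ) = n • MonoidAlgebra.single t 1 := by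
        rw [MonoidAlgebra.smul_single]; simp
      have hz : ∀ u : MonoidAlgebra ℤ Γ, pairing x (n • u) = n • pairing x u := by
        intro u
        exact map_zsmul (AddMonoidHom.mk' (pairing x) (pairing_add x)) n u
      rw [e, smul_mul_assoc, hz, ← key, hx, smul_zero]

theorem continuous_pairing (g : MonoidAlgebra ℤ Γ) :
    Continuous fun x : Γ → UnitAddCircle => pairing x g := by
  unfold pairing Finsupp.sum
  fun_prop

theorem isClosed_principalGroup (f : MonoidAlgebra ℤ Γ) :
    IsClosed (principalGroup f : Set (Γ → UnitAddCircle)) := by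
  have h : (principalGroup f : Set (Γ → UnitAddCircle))
      = ⋂ g ∈ Ideal.span {f}, {x | pairing x g = 0} := by
    ext x
    simp [principalGroup]
  rw [h]
  exact isClosed_biInter fun g _ => isClosed_eq (continuous_pairing g) continuous_const

instance (f : MonoidAlgebra ℤ Γ) : CompactSpace (principalGroup f) :=
  isCompact_iff_compactSpace.1 (isClosed_principalGroup f).isCompact

theorem shift_mem (f : MonoidAlgebra ℤ Γ) (s : Γ) {x : Γ → UnitAddCircle}
    (hx : x ∈ principalGroup f) : shift UnitAddCircle s x ∈ principalGroup f := by
  intro g hg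
  rw [pairing_shift]
  exact hx _ (Ideal.mul_mem_left _ _ hg)

theorem continuous_shift (s : Γ) : Continuous (shift UnitAddCircle s) :=
  continuous_pi fun t => continuous_apply (s⁻¹ * t)

/-- The principal algebraic action `α_f` of `Γ` on `X_f` by continuous automorphisms:
the restriction of the shift action. -/
def principalAction (f : MonoidAlgebra ℤ Γ) (s : Γ) : principalGroup f ≃ₜ+ principalGroup f where
  toFun x := ⟨shift UnitAddCircle s x, shift_mem f s x.2⟩
  invFun x := ⟨shift UnitAddCircle s⁻¹ x, shift_mem f s⁻¹ x.2⟩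
  left_inv x := by ext t; simp
  right_inv x := by ext t; simp
  map_add' _ _ := rfl
  continuous_toFun := ((continuous_shift s).comp continuous_subtype_val).subtype_mk _
  continuous_invFun := ((continuous_shift s⁻¹).comp continuous_subtype_val).subtype_mk _

theorem principalAction_one (f : MonoidAlgebra ℤ Γ) (x : principalGroup f) :
    principalAction f 1 x = x := by
  apply Subtype.ext
  simp [principalAction]

theorem principalAction_mul (f : MonoidAlgebra ℤ Γ) (s u : Γ) (x : principalGroup f) :
    principalAction f (s * u) x = principalAction f s (principalAction f u x) := by
  apply Subtype.ext
  simp [principalAction]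

/-- Normalized Haar measure `μ_f` on the compact group `X_f`. The underlying σ-algebra is the one
induced by the product σ-algebra of `𝕋^Γ`; it is the Borel σ-algebra as `Γ` is countable. -/
def principalHaar [Countable Γ] (f : MonoidAlgebra ℤ Γ) : Measure (principalGroup f) :=
  Measure.addHaarMeasure ⊤

/-- The Bernoulli measure on `{0, …, M - 1}^Γ` with uniform base measure. -/
def bernoulliMeasure (Γ : Type*) (M : ℕ) : Measure (Γ → Fin M) :=
  Measure.infinitePi fun _ : Γ => ProbabilityTheory.uniformOn (Set.univ : Set (Fin M))

/-- The involution `f* = ∑_s f_s s⁻¹` of `ℤΓ`. -/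
def involution (f : MonoidAlgebra ℤ Γ) : MonoidAlgebra ℤ Γ :=
  MonoidAlgebra.ofCoeff (f.coeff.mapDomain fun s => s⁻¹)

/-- `w ∈ ℓ¹(Γ, ℝ)` is the inverse of `g ∈ ℤΓ` in the convolution algebra `ℓ¹(Γ, ℝ)`, that is
`w · g = 1 = g · w`, where `(w · g)_t = ∑_s w_{t s⁻¹} g_s` and `(g · w)_t = ∑_s g_s w_{s⁻¹ t}`. -/
structure IsSummableInverse (g : MonoidAlgebra ℤ Γ) (w : Γ → ℝ) : Prop where
  summable : Summable fun s => |w s|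
  mul_eq_one : ∀ t : Γ, (g.coeff.sum fun s n => w (t * s⁻¹) * (n : ℝ))
    = (((1 : MonoidAlgebra ℤ Γ).coeff t : ℤ) : ℝ)
  one_eq_mul : ∀ t : Γ, (g.coeff.sum fun s n => (n : ℝ) * w (s⁻¹ * t))
    = (((1 : MonoidAlgebra ℤ Γ).coeff t : ℤ) : ℝ)

/-- The homoclinic map `d ↦ π (d · w)` for `w ∈ ℓ¹(Γ, ℝ)` on points `d ∈ {0, …, M - 1}^Γ`,
where `(d · w)_s = ∑_t d_t w_{t⁻¹ s}` and `π` reduces each coordinate modulo `1`. -/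
def homoclinicMap (M : ℕ) (w : Γ → ℝ) (d : Γ → Fin M) : Γ → UnitAddCircle :=
  fun s => ((∑' t : Γ, ((d t : ℕ) : ℝ) * w (t⁻¹ * s) : ℝ) : UnitAddCircle)

/-- `φ` is a measurable isomorphism from the measure-preserving system `(Y, S, ν)` to `(X, T, μ)`:
it is measure preserving, equivariant almost everywhere, and has a measure-preserving inverse
modulo null sets. -/
structure IsMeasurableIsomorphism {Γ Y X : Type*} [MeasurableSpace Y] [MeasurableSpace X]
    (ν : Measure Y) (S : Γ → Y → Y) (μ : Measure X) (T : Γ → X → X) (φ : Y → X) : Prop where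
  measurePreserving : MeasurePreserving φ ν μ
  equivariant : ∀ s : Γ, ∀ᵐ y ∂ν, φ (S s y) = T s (φ y)
  exists_inverse : ∃ ψ : X → Y, MeasurePreserving ψ μ ν ∧
    (∀ᵐ y ∂ν, ψ (φ y) = y) ∧ ∀ᵐ x ∂μ, φ (ψ x) = x

end PrincipalAction

end

noncomputable section

namespace PrincipalAction

variable {Γ : Type*} [Group Γ]

open scoped BoundedContinuousFunction

/-! The inverse of `f* = M - a⁻¹ - b⁻¹` is the Neumann series `w = ∑ (a⁻¹ + b⁻¹)^n / M^(n+1)`,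
convergent because `2 < M` and supported in degrees `≤ 0`. For the real lift `x = d · w`, the
equation `x f* = d` is integral, so `x` mod 1 lies in `X_f` (`mul_homoclinicLift_greenFunction`).

Haar image (`integral_toCircle_pairing_homoclinicMap`): pairing with `g` turns `φ` into `∑ d_t h_t`
mod 1, where `h = g w*` satisfies `h f = g`. If `g ∉ ℤΓ f`, then `h` has a non-integral value. Take
one, at `t`, of least degree; then `M h_t` is an integer, so rotating the digit at `t` preserves `ν`
and multiplies the character by `exp(2πi h_t) ≠ 1`. Its integral is therefore zero.

Injectivity almost everywhere (`ae_exists_carry_eq_zero`,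
`exists_measurableSet_injOn_homoclinicMap`): two lifts with the same image differ by a bounded
integer-valued `n` with `M n_s ≤ d_s + n_{sa} + n_{sb}`. Iterating this with rounding down bounds
`n` by carries whose mean after `k` steps is `(2/M)^k C`. Almost surely some carry vanishes at each
site, so `n ≤ 0`; by symmetry `n = 0`. Descriptive set theory then supplies the measurable inverse.
-/

/-- The number of words of length `n` in `a⁻¹` and `b⁻¹` that represent `t`. -/
def wordCount (a b : Γ) : ℕ → Γ → ℝ
  | 0 => Set.indicator {1} 1
  | n + 1 => fun t => wordCount a b n (a * t) + wordCount a b n (b * t)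

/-! ### The Neumann series for the inverse of `f*` -/

section wordCount

variable (a b : Γ)

theorem indicator_one_mul_comm (s t : Γ) :
    Set.indicator {1} (1 : Γ → ℝ) (s * t) = Set.indicator {1} (1 : Γ → ℝ) (t * s) := by
  classical
  simp only [Set.indicator_apply, Set.mem_singleton_iff, Pi.one_apply,
    mul_eq_one_comm (a := s)]

/-- A letter can be peeled off either end of a word; this makes the inverse two-sided. -/
theorem wordCount_succ_right (n : ℕ) (t : Γ) :
    wordCount a b (n + 1) t = wordCount a b n (t * a) + wordCount a b n (t * b) := by
  induction n generalizing t with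
  | zero => simp only [wordCount, indicator_one_mul_comm]
  | succ n ih =>
    change wordCount a b (n + 1) (a * t) + wordCount a b (n + 1) (b * t) =
      (wordCount a b n (a * (t * a)) + wordCount a b n (b * (t * a))) +
      (wordCount a b n (a * (t * b)) + wordCount a b n (b * (t * b)))
    rw [ih, ih]
    simp only [mul_assoc]
    ring

theorem wordCount_nonneg (n : ℕ) (t : Γ) : 0 ≤ wordCount a b n t := by
  induction n generalizing t with
  | zero => exact Set.indicator_nonneg (fun _ _ => zero_le_one) _
  | succ n ih => exact add_nonneg (ih _) (ih _)

theorem hasSum_wordCount (n : ℕ) : HasSum (wordCount a b n) (2 ^ n) := by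
  induction n with
  | zero =>
    classical
    have h := hasSum_ite_eq (1 : Γ) (1 : ℝ)
    convert h using 1
    · funext t; simp [wordCount, Set.indicator_apply]
    · simp
  | succ n ih =>
    have h := ((Equiv.mulLeft a).hasSum_iff.2 ih).add ((Equiv.mulLeft b).hasSum_iff.2 ih)
    rw [pow_succ, mul_two]
    exact h

theorem wordCount_le (n : ℕ) (t : Γ) : wordCount a b n t ≤ 2 ^ n :=
  le_hasSum (hasSum_wordCount a b n) t fun s _ => wordCount_nonneg a b n s

theorem deg_of_wordCount_ne_zero {a b : Γ} (deg : Γ →* Multiplicative ℤ)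
    (ha : deg a = Multiplicative.ofAdd 1) (hb : deg b = Multiplicative.ofAdd 1) {n : ℕ} {t : Γ}
    (h : wordCount a b n t ≠ 0) : (deg t).toAdd = -n := by
  induction n generalizing t with
  | zero =>
    have : t = 1 := by
      by_contra h1
      exact h (by simp [wordCount, h1])
    simp [this]
  | succ n ih =>
    have : wordCount a b n (a * t) ≠ 0 ∨ wordCount a b n (b * t) ≠ 0 := by
      by_contra! h0
      exact h (by simp [wordCount, h0.1, h0.2])
    rcases this with h | h <;>
    · have := ih h
      simp only [map_mul, ha, hb, toAdd_mul, toAdd_ofAdd] at this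
      push_cast
      linarith

end wordCount

/-- The inverse `∑ n, (a⁻¹ + b⁻¹) ^ n / M ^ (n + 1)` of `M - a⁻¹ - b⁻¹` in `ℓ¹(Γ, ℝ)`. -/
def greenFunction (M : ℕ) (a b : Γ) (t : Γ) : ℝ :=
  ∑' n : ℕ, wordCount a b n t / (M : ℝ) ^ (n + 1)

section greenFunction

variable {M : ℕ} (hM : 3 ≤ M) (a b : Γ)
include hM

theorem summable_two_pow_div : Summable fun n : ℕ => (2 : ℝ) ^ n / (M : ℝ) ^ (n + 1) := by
  have hM' : (3 : ℝ) ≤ M := by exact_mod_cast hM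
  have h : Summable fun n : ℕ => ((2 : ℝ) / M) ^ n * (1 / M) :=
    (summable_geometric_of_lt_one (by positivity)
      (by rw [div_lt_one (by linarith)]; linarith)).mul_right _
  refine h.congr fun n => ?_
  rw [div_pow, pow_succ]
  field_simp

theorem summable_wordCount_div (t : Γ) :
    Summable fun n : ℕ => wordCount a b n t / (M : ℝ) ^ (n + 1) :=
  Summable.of_nonneg_of_le (fun n => div_nonneg (wordCount_nonneg a b n t) (by positivity))
    (fun n => by gcongr; exact wordCount_le a b n t) (summable_two_pow_div hM)

/-- Tonelli on `ℕ × Γ`: row `n` has mass `2^n / M^(n+1)`. -/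
theorem summable_greenFunction : Summable (greenFunction M a b) := by
  let F : ℕ × Γ → ℝ := fun p => wordCount a b p.1 p.2 / (M : ℝ) ^ (p.1 + 1)
  have hF : 0 ≤ F := by
    intro p
    change 0 ≤ wordCount a b p.1 p.2 / (M : ℝ) ^ (p.1 + 1)
    exact div_nonneg (wordCount_nonneg a b p.1 p.2) (by positivity)
  have h : Summable F := by
    refine (summable_prod_of_nonneg hF).2 ⟨fun n => ?_, ?_⟩
    · change Summable fun t => wordCount a b n t / (M : ℝ) ^ (n + 1)
      exact (hasSum_wordCount a b n).summable.div_const _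
    · refine (summable_two_pow_div hM).congr fun n => ?_
      change _ = ∑' t, wordCount a b n t / (M : ℝ) ^ (n + 1)
      rw [tsum_div_const, (hasSum_wordCount a b n).tsum_eq]
  exact h.prod_symm.prod

/-- Splits off the empty word; either recursion for `wordCount` then gives a resolvent equation. -/
theorem mul_greenFunction_aux (t : Γ) : M * greenFunction M a b t =
    Set.indicator {1} 1 t + ∑' n : ℕ, wordCount a b (n + 1) t / (M : ℝ) ^ (n + 1) := by
  have hM' : (M : ℝ) ≠ 0 := by positivity
  rw [greenFunction, (summable_wordCount_div hM a b t).tsum_eq_zero_add, mul_add, ← tsum_mul_left]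
  congr 1
  · simp [wordCount]; field_simp
  · refine tsum_congr fun n => ?_
    rw [pow_succ _ (n + 1)]
    field_simp

theorem mul_greenFunction_left (t : Γ) : M * greenFunction M a b t =
    Set.indicator {1} 1 t + greenFunction M a b (a * t) + greenFunction M a b (b * t) := by
  rw [mul_greenFunction_aux hM, add_assoc, greenFunction, greenFunction,
    ← (summable_wordCount_div hM a b _).tsum_add (summable_wordCount_div hM a b _)]
  simp only [wordCount, add_div]

theorem mul_greenFunction_right (t : Γ) : M * greenFunction M a b t =
    Set.indicator {1} 1 t + greenFunction M a b (t * a) + greenFunction M a b (t * b) := by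
  rw [mul_greenFunction_aux hM, add_assoc, greenFunction, greenFunction,
    ← (summable_wordCount_div hM a b _).tsum_add (summable_wordCount_div hM a b _)]
  simp only [wordCount_succ_right, add_div]

omit hM in
theorem deg_nonpos_of_greenFunction_ne_zero {a b : Γ} (deg : Γ →* Multiplicative ℤ)
    (ha : deg a = Multiplicative.ofAdd 1) (hb : deg b = Multiplicative.ofAdd 1) {t : Γ}
    (h : greenFunction M a b t ≠ 0) : (deg t).toAdd ≤ 0 := by
  by_contra! hlt
  apply h
  have : ∀ n, wordCount a b n t = 0 := fun n => by
    by_contra hn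
    have := deg_of_wordCount_ne_zero deg ha hb hn
    linarith [Int.natCast_nonneg n]
  simp [greenFunction, this]

end greenFunction

/-- The element `M - a - b` of the integral group ring. -/
def trinomial (M : ℕ) (a b : Γ) : MonoidAlgebra ℤ Γ :=
  MonoidAlgebra.single 1 (M : ℤ) - MonoidAlgebra.single a 1 - MonoidAlgebra.single b 1

theorem sum_coeff_trinomial {A : Type*} [AddCommGroup A] (M : ℕ) (a b : Γ) {h : Γ → ℤ → A}
    (hsub : ∀ s m n, h s (m - n) = h s m - h s n) :
    (trinomial M a b).coeff.sum h = h 1 M - h a 1 - h b 1 := by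
  have h0 : ∀ s, h s 0 = 0 := fun s => by simpa using hsub s 0 0
  rw [trinomial, MonoidAlgebra.coeff_sub, MonoidAlgebra.coeff_sub, Finsupp.sum_sub_index hsub,
    Finsupp.sum_sub_index hsub]
  simp only [MonoidAlgebra.coeff_single, Finsupp.sum_single_index, h0]

theorem involution_trinomial (M : ℕ) (a b : Γ) :
    involution (trinomial M a b) = trinomial M a⁻¹ b⁻¹ := by
  have hsub : ∀ x y : Γ →₀ ℤ, (x - y).mapDomain (fun s : Γ => s⁻¹)
      = x.mapDomain (fun s => s⁻¹) - y.mapDomain fun s => s⁻¹ := fun x y =>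
    map_sub (Finsupp.mapDomain.addMonoidHom fun s : Γ => s⁻¹) x y
  rw [← MonoidAlgebra.coeff_inj, involution, MonoidAlgebra.coeff_ofCoeff]
  simp only [trinomial, MonoidAlgebra.coeff_sub, MonoidAlgebra.coeff_single, hsub,
    Finsupp.mapDomain_single, inv_one]

theorem isSummableInverse_greenFunction {M : ℕ} (hM : 3 ≤ M) (a b : Γ) :
    IsSummableInverse (involution (trinomial M a b)) (greenFunction M a b) := by
  classical
  have h1 : ∀ t : Γ, (((1 : MonoidAlgebra ℤ Γ).coeff t : ℤ) : ℝ) = Set.indicator {1} 1 t := by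
    intro t
    rw [MonoidAlgebra.one_def, MonoidAlgebra.coeff_single, Finsupp.single_apply]
    by_cases h : t = 1 <;> simp [h, eq_comm]
  refine ⟨(summable_greenFunction hM a b).abs, fun t => ?_, fun t => ?_⟩
  · rw [involution_trinomial, sum_coeff_trinomial _ _ _ (fun _ _ _ => by push_cast; ring), h1]
    simp only [inv_one, inv_inv, mul_one, Int.cast_natCast, Int.cast_one]
    linarith [mul_greenFunction_right hM a b t]
  · rw [involution_trinomial, sum_coeff_trinomial _ _ _ (fun _ _ _ => by push_cast; ring), h1]
    simp only [inv_one, inv_inv, one_mul, Int.cast_natCast, Int.cast_one]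
    linarith [mul_greenFunction_left hM a b t]

/-! ### The real lift of the homoclinic map -/

/-- The real point `d · w` that lifts `homoclinicMap M w d`. -/
def homoclinicLift (M : ℕ) (w : Γ → ℝ) (d : Γ → Fin M) (s : Γ) : ℝ :=
  ∑' t : Γ, ((d t : ℕ) : ℝ) * w (t⁻¹ * s)

section homoclinicLift

variable {M : ℕ} {w : Γ → ℝ}

theorem summable_inv_mul (hw : Summable w) (s : Γ) : Summable fun t : Γ => w (t⁻¹ * s) :=
  ((Equiv.inv Γ).trans (Equiv.mulRight s)).summable_iff.2 hw

theorem tsum_inv_mul (w : Γ → ℝ) (s : Γ) : ∑' t : Γ, w (t⁻¹ * s) = ∑' t, w t :=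
  ((Equiv.inv Γ).trans (Equiv.mulRight s)).tsum_eq w

theorem norm_digit_mul_le (i : Fin M) (x : ℝ) : ‖((i : ℕ) : ℝ) * x‖ ≤ M * |x| := by
  rw [Real.norm_eq_abs, abs_mul, Nat.abs_cast]
  gcongr
  exact i.2.le

theorem summable_digit_mul {ι : Type*} {h : ι → ℝ} (hh : Summable h) (d : ι → Fin M) :
    Summable fun t => ((d t : ℕ) : ℝ) * h t :=
  Summable.of_norm_bounded (hh.abs.mul_left (M : ℝ)) fun t => norm_digit_mul_le (d t) (h t)

theorem abs_homoclinicLift_le (hw : Summable w) (d : Γ → Fin M) (s : Γ) :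
    |homoclinicLift M w d s| ≤ M * ∑' t, |w t| := by
  have h := (summable_inv_mul hw s)
  calc |homoclinicLift M w d s| ≤ ∑' t, ‖((d t : ℕ) : ℝ) * w (t⁻¹ * s)‖ :=
        norm_tsum_le_tsum_norm (summable_digit_mul h d).norm
    _ ≤ ∑' t : Γ, M * |w (t⁻¹ * s)| :=
        (summable_digit_mul h d).norm.tsum_le_tsum (fun t => norm_digit_mul_le _ _)
          (h.abs.mul_left _)
    _ = M * ∑' t, |w t| := by rw [tsum_mul_left, tsum_inv_mul fun t => |w t|]

theorem homoclinicLift_shift (d : Γ → Fin M) (u s : Γ) :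
    homoclinicLift M w (shift (Fin M) u d) s = homoclinicLift M w d (u⁻¹ * s) := by
  rw [homoclinicLift, homoclinicLift, ← (Equiv.mulLeft u).tsum_eq]
  simp [shift, mul_assoc]

theorem continuous_homoclinicMap (hw : Summable w) : Continuous (homoclinicMap M w) :=
  continuous_pi fun s => (AddCircle.continuous_mk' 1).comp <|
    continuous_tsum (u := fun t : Γ => M * |w (t⁻¹ * s)|)
      (fun t => (continuous_of_discreteTopology (f := fun i : Fin M => ((i : ℕ) : ℝ)
        * w (t⁻¹ * s))).comp (continuous_apply t))
      ((summable_inv_mul hw s).abs.mul_left _) fun t d => norm_digit_mul_le (d t) _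

/-- This is `(d · w) f* = d`. It gives membership in `X_f` and recovers the digits from the lift. -/
theorem mul_homoclinicLift_greenFunction (hM : 3 ≤ M) (a b : Γ) (d : Γ → Fin M) (s : Γ) :
    M * homoclinicLift M (greenFunction M a b) d s = (d s : ℕ)
      + homoclinicLift M (greenFunction M a b) d (s * a)
      + homoclinicLift M (greenFunction M a b) d (s * b) := by
  classical
  have hw := summable_greenFunction hM a b
  have hs := fun u => summable_digit_mul (summable_inv_mul hw u) d
  have h1 : HasSum (fun t : Γ => ((d t : ℕ) : ℝ) * Set.indicator {1} 1 (t⁻¹ * s)) (d s : ℕ) := by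
    convert hasSum_ite_eq s ((d s : ℕ) : ℝ) using 2 with t
    by_cases h : t = s
    · simp [h]
    · simp [h, inv_mul_eq_one]
  have h2 := ((h1.add (hs (s * a)).hasSum).add (hs (s * b)).hasSum).tsum_eq
  rw [homoclinicLift, ← tsum_mul_left]
  refine Eq.trans (tsum_congr fun t => ?_) h2
  rw [mul_left_comm, mul_greenFunction_right hM]
  simp only [mul_assoc]
  ring

theorem homoclinicMap_mem (hM : 3 ≤ M) (a b : Γ) (d : Γ → Fin M) :
    homoclinicMap M (greenFunction M a b) d ∈ principalGroup (trinomial M a b) := by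
  rw [mem_principalGroup_iff]
  intro t
  rw [sum_coeff_trinomial _ _ _ fun s m n => sub_smul m n _]
  have h := mul_homoclinicLift_greenFunction hM a b d t
  change (M : ℤ) • ((homoclinicLift M (greenFunction M a b) d (t * 1) : ℝ) : UnitAddCircle)
    - (1 : ℤ) • ((homoclinicLift M (greenFunction M a b) d (t * a) : ℝ) : UnitAddCircle)
    - (1 : ℤ) • ((homoclinicLift M (greenFunction M a b) d (t * b) : ℝ) : UnitAddCircle) = 0
  rw [← AddCircle.coe_zsmul, ← AddCircle.coe_zsmul, ← AddCircle.coe_zsmul, ← AddCircle.coe_sub,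
    ← AddCircle.coe_sub, AddCircle.coe_eq_zero_iff]
  refine ⟨(d t : ℕ), ?_⟩
  simp only [zsmul_eq_mul, mul_one, Int.cast_natCast, Int.cast_one, one_mul]
  linarith

end homoclinicLift

/-! ### Digit rotations of the Bernoulli measure -/

section rotation

variable {ι : Type*} {M : ℕ} [NeZero M]

instance : IsProbabilityMeasure (bernoulliMeasure ι M) := by
  unfold bernoulliMeasure; infer_instance

theorem measurePreserving_add_right (c : ι → Fin M) :
    MeasurePreserving (fun d : ι → Fin M => d + c) (bernoulliMeasure ι M)
      (bernoulliMeasure ι M) := by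
  have h : ∀ j : Fin M, (ProbabilityTheory.uniformOn (Set.univ : Set (Fin M))).map (· + j)
      = ProbabilityTheory.uniformOn Set.univ := by
    intro j
    ext s hs
    rw [Measure.map_apply (by fun_prop) hs, ProbabilityTheory.uniformOn_univ,
      ProbabilityTheory.uniformOn_univ, ← Measure.map_apply (by fun_prop) hs,
      map_add_right_eq_self]
  refine ⟨by fun_prop, ?_⟩
  have := Measure.infinitePi_map_pi
    (fun _ : ι => ProbabilityTheory.uniformOn (Set.univ : Set (Fin M)))
    (f := fun i x => x + c i) fun i => by fun_prop
  simp only [h] at this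
  exact this

/-- Averaging over rotations integrates out the digit at `s` without splitting the product measure.
-/
theorem natCast_mul_lintegral_bernoulliMeasure [DecidableEq ι] {F : (ι → Fin M) → ENNReal}
    (hF : Measurable F) (s : ι) : M * ∫⁻ d, F d ∂bernoulliMeasure ι M =
      ∫⁻ d, ∑ j : Fin M, F (d + Pi.single s j) ∂bernoulliMeasure ι M := by
  have h := lintegral_finsetSum (μ := bernoulliMeasure ι M) Finset.univ
    (f := fun (j : Fin M) d => F (d + Pi.single s j)) fun j _ =>
      hF.comp (measurePreserving_add_right (Pi.single s j)).measurable
  rw [h]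
  simp only [(measurePreserving_add_right (Pi.single s _)).lintegral_comp hF, Finset.sum_const,
    Finset.card_univ, Fintype.card_fin, nsmul_eq_mul]

end rotation

/-! ### Carries and injectivity almost everywhere -/

/-- Hermite's identity: raising `m` by one shifts the window, trading the term `m / M` for `(M + m)
/ M = m / M + 1`. Thus rounding down against a uniform digit costs exactly that digit's
contribution. -/
theorem sum_range_add_div {M : ℕ} (hM : 0 < M) (m : ℕ) :
    ∑ j ∈ Finset.range M, (j + m) / M = m := by
  induction m with
  | zero => exact Finset.sum_eq_zero fun j hj => Nat.div_eq_of_lt (by simpa using hj)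
  | succ m ih =>
    have h1 := Finset.sum_range_succ (fun j => (j + m) / M) M
    have h2 := Finset.sum_range_succ' (fun j => (j + m) / M) M
    have h3 : (M + m) / M = m / M + 1 := Nat.add_div_left m hM
    rw [ih, h3] at h1
    simp only [zero_add] at h2
    have h4 : ∑ j ∈ Finset.range M, (j + (m + 1)) / M
        = ∑ j ∈ Finset.range M, (j + 1 + m) / M :=
      Finset.sum_congr rfl fun j _ => by rw [add_right_comm, add_assoc]
    omega

theorem sum_digit_add_div {M : ℕ} [NeZero M] (i : Fin M) (m : ℕ) :
    ∑ j : Fin M, (((i + j : Fin M) : ℕ) + m) / M = m := by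
  have h := Equiv.sum_comp (Equiv.addLeft i) fun j : Fin M => ((j : ℕ) + m) / M
  simp only [Equiv.coe_addLeft] at h
  rw [h, Fin.sum_univ_eq_sum_range fun j => (j + m) / M, sum_range_add_div (NeZero.pos M)]

/-- Upper bounds for the integer-valued `n ≤ C` with `M n_s - n_{sa} - n_{sb} ≤ d_s`. -/
def carry {M : ℕ} (a b : Γ) (C : ℕ) : ℕ → (Γ → Fin M) → Γ → ℕ
  | 0 => fun _ _ => C
  | k + 1 => fun d s => ((d s : ℕ) + (carry a b C k d (s * a) + carry a b C k d (s * b))) / M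

section carry

variable {M : ℕ} {a b : Γ} {C : ℕ}

theorem carry_succ (k : ℕ) (d : Γ → Fin M) (s : Γ) : carry a b C (k + 1) d s =
    ((d s : ℕ) + (carry a b C k d (s * a) + carry a b C k d (s * b))) / M := rfl

/-- Since `n` is integer-valued, each iterated bound may be rounded down. -/
theorem le_carry (hM : 0 < M) {d : Γ → Fin M} {n : Γ → ℤ} (hC : ∀ s, n s ≤ C)
    (hn : ∀ s, M * n s ≤ (d s : ℕ) + n (s * a) + n (s * b)) (k : ℕ) (s : Γ) :
    n s ≤ carry a b C k d s := by
  induction k generalizing s with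
  | zero => exact hC s
  | succ k ih =>
    have h : M * n s ≤ ((d s : ℕ) + (carry a b C k d (s * a) + carry a b C k d (s * b)) : ℕ) := by
      push_cast
      linarith [hn s, ih (s * a), ih (s * b)]
    rw [carry_succ, Int.natCast_div]
    exact (Int.le_ediv_iff_mul_le (by exact_mod_cast hM)).2 (by linarith)

/-- The recursion only moves up in degree, so carries at `s * a` and `s * b` do not see the digit at
`s`. -/
theorem carry_congr (deg : Γ →* Multiplicative ℤ)
    (ha : deg a = Multiplicative.ofAdd 1) (hb : deg b = Multiplicative.ofAdd 1)
    {d d' : Γ → Fin M} {s : Γ} (h : ∀ t, (deg s).toAdd ≤ (deg t).toAdd → d t = d' t) (k : ℕ) :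
    carry a b C k d s = carry a b C k d' s := by
  induction k generalizing s with
  | zero => rfl
  | succ k ih =>
    rw [carry_succ, carry_succ, h s le_rfl, ih (s := s * a), ih (s := s * b)] <;>
    · intro t ht
      refine h t ?_
      simp only [map_mul, ha, hb, toAdd_mul, toAdd_ofAdd] at ht
      linarith

theorem measurable_carry (k : ℕ) (s : Γ) :
    Measurable fun d : Γ → Fin M => carry a b C k d s := by
  induction k generalizing s with
  | zero => exact measurable_const
  | succ k ih =>
    have h : Measurable fun d : Γ → Fin M => ((d s : Fin M) : ℕ) :=
      (Measurable.of_discrete (f := fun i : Fin M => (i : ℕ))).comp (measurable_pi_apply s)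
    exact (Measurable.of_discrete (f := fun n : ℕ => n / M)).comp
      (h.add ((ih (s * a)).add (ih (s * b))))

theorem measurable_natCast_carry (k : ℕ) (s : Γ) :
    Measurable fun d : Γ → Fin M => (carry a b C k d s : ENNReal) := by
  have h : Measurable fun n : ℕ => (n : ENNReal) := Measurable.of_discrete
  exact h.comp (measurable_carry k s)

/-- The incoming carries are unchanged when the digit at `s` rotates, so Hermite's identity
evaluates the average exactly. -/
theorem lintegral_carry_succ [NeZero M] (deg : Γ →* Multiplicative ℤ)
    (ha : deg a = Multiplicative.ofAdd 1) (hb : deg b = Multiplicative.ofAdd 1) (k : ℕ) (s : Γ) :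
    M * ∫⁻ d, (carry a b C (k + 1) d s : ENNReal) ∂bernoulliMeasure Γ M =
      ∫⁻ d, (carry a b C k d (s * a) : ENNReal) ∂bernoulliMeasure Γ M
      + ∫⁻ d, (carry a b C k d (s * b) : ENNReal) ∂bernoulliMeasure Γ M := by
  classical
  have hne : ∀ g : Γ, deg g = Multiplicative.ofAdd 1 →
      ∀ t, (deg (s * g)).toAdd ≤ (deg t).toAdd → t ≠ s := by
    rintro g hg t ht rfl
    simp [hg] at ht
  rw [natCast_mul_lintegral_bernoulliMeasure (measurable_natCast_carry (k + 1) s) s,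
    ← lintegral_add_left (measurable_natCast_carry k (s * a))]
  refine lintegral_congr fun d => ?_
  have hinv : ∀ g : Γ, deg g = Multiplicative.ofAdd 1 → ∀ j : Fin M,
      carry a b C k (d + Pi.single s j) (s * g) = carry a b C k d (s * g) := fun g hg j =>
    carry_congr deg ha hb (fun t ht => by simp [hne g hg t ht]) k
  rw [← Nat.cast_sum, ← Nat.cast_add]
  congr 1
  simp only [carry_succ, hinv a ha, hinv b hb, Pi.add_apply, Pi.single_eq_same]
  exact sum_digit_add_div (d s) _

theorem lintegral_carry [NeZero M] (deg : Γ →* Multiplicative ℤ)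
    (ha : deg a = Multiplicative.ofAdd 1) (hb : deg b = Multiplicative.ofAdd 1) (k : ℕ) (s : Γ) :
    M ^ k * ∫⁻ d, (carry a b C k d s : ENNReal) ∂bernoulliMeasure Γ M = 2 ^ k * C := by
  induction k generalizing s with
  | zero => simp [carry]
  | succ k ih =>
    rw [pow_succ, mul_assoc, lintegral_carry_succ deg ha hb, mul_add, ih, ih]
    ring

theorem ae_exists_carry_eq_zero (hM : 3 ≤ M) (deg : Γ →* Multiplicative ℤ)
    (ha : deg a = Multiplicative.ofAdd 1) (hb : deg b = Multiplicative.ofAdd 1) (s : Γ) :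
    ∀ᵐ d ∂bernoulliMeasure Γ M, ∃ k, carry a b C k d s = 0 := by
  have : NeZero M := ⟨by omega⟩
  rw [ae_iff]
  set p := bernoulliMeasure Γ M {d | ¬∃ k, carry a b C k d s = 0}
  have hp : p ≠ ⊤ := measure_ne_top _ _
  -- Markov's inequality at level 1: a nonzero carry is at least 1.
  have hle : ∀ k, (3 : ENNReal) ^ k * p ≤ 2 ^ k * C := by
    intro k
    rw [← lintegral_carry (M := M) deg ha hb k s]
    gcongr
    · exact_mod_cast hM
    · rw [← one_mul p]
      refine le_trans ?_ (mul_meas_ge_le_lintegral₀ (ε := 1)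
        (measurable_natCast_carry k s).aemeasurable)
      gcongr 1 * ?_
      refine measure_mono fun d hd => ?_
      have : carry a b C k d s ≠ 0 := fun h => hd ⟨k, h⟩
      change (1 : ENNReal) ≤ (carry a b C k d s : ENNReal)
      exact_mod_cast Nat.one_le_iff_ne_zero.2 this
  have hle' : ∀ k, p.toReal ≤ (2 / 3 : ℝ) ^ k * C := by
    intro k
    have h := ENNReal.toReal_mono (by finiteness) (hle k)
    simp only [ENNReal.toReal_mul, ENNReal.toReal_pow, ENNReal.toReal_ofNat,
      ENNReal.toReal_natCast] at h
    rw [div_pow, div_mul_eq_mul_div, le_div_iff₀ (by positivity)]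
    linarith
  have hlim : Filter.Tendsto (fun k : ℕ => (2 / 3 : ℝ) ^ k * C) Filter.atTop (nhds (0 * C)) :=
    (tendsto_pow_atTop_nhds_zero_of_lt_one (by norm_num) (by norm_num)).mul_const _
  rw [zero_mul] at hlim
  have h0 : p.toReal = 0 := le_antisymm (ge_of_tendsto' hlim hle') ENNReal.toReal_nonneg
  exact ((ENNReal.toReal_eq_zero_iff p).1 h0).resolve_right hp

end carry

theorem exists_int_eq_of_coe_eq_coe {x y : ℝ} (h : (x : UnitAddCircle) = y) :
    ∃ n : ℤ, (n : ℝ) = x - y := by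
  obtain ⟨n, hn⟩ := (AddCircle.coe_eq_zero_iff (1 : ℝ) (x := x - y)).1
    (by rw [AddCircle.coe_sub, h, sub_self])
  exact ⟨n, by simpa using hn⟩

theorem exists_measurableSet_injOn_homoclinicMap [Countable Γ] {M : ℕ} (hM : 3 ≤ M)
    (deg : Γ →* Multiplicative ℤ) {a b : Γ}
    (ha : deg a = Multiplicative.ofAdd 1) (hb : deg b = Multiplicative.ofAdd 1) :
    ∃ S : Set (Γ → Fin M), MeasurableSet S ∧ (∀ᵐ d ∂bernoulliMeasure Γ M, d ∈ S) ∧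
      Set.InjOn (homoclinicMap M (greenFunction M a b)) S := by
  set w := greenFunction M a b
  have hw : Summable w := summable_greenFunction hM a b
  -- `C` bounds the difference of any two lifts, at every site.
  obtain ⟨C, hC⟩ := exists_nat_ge (M * ∑' t, |w t| + M * ∑' t, |w t|)
  refine ⟨{d | ∀ s, ∃ k, carry a b C k d s = 0}, ?_, ?_, ?_⟩
  · simp only [Set.ofPred_forall, Set.ofPred_exists]
    exact MeasurableSet.iInter fun s => MeasurableSet.iUnion fun k =>
      measurable_carry k s (measurableSet_singleton 0)
  · exact ae_all_iff.2 fun s => ae_exists_carry_eq_zero hM deg ha hb s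
  -- One-sided: only the carries of `d` must die out, and `d'` enters only through `0 ≤ d'_s`.
  · have hle : ∀ d d' : Γ → Fin M, (∀ s, ∃ k, carry a b C k d s = 0) →
        homoclinicMap M w d = homoclinicMap M w d' →
        ∀ s, homoclinicLift M w d s ≤ homoclinicLift M w d' s := by
      intro d d' hd h
      choose n hn using fun s => exists_int_eq_of_coe_eq_coe (congrFun h s)
      replace hn : ∀ s, (n s : ℝ) = homoclinicLift M w d s - homoclinicLift M w d' s := hn
      intro s
      obtain ⟨k, hk⟩ := hd s
      have h0 := le_carry (a := a) (b := b) (C := C) (d := d) (n := n) (by omega)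
        (fun s => ?_) (fun s => ?_) k s
      · rw [hk, Nat.cast_zero] at h0
        have : (n s : ℝ) ≤ 0 := by exact_mod_cast h0
        linarith [hn s]
      · have : (n s : ℝ) ≤ C := by
          have h1 := abs_le.1 (abs_homoclinicLift_le hw d s)
          have h2 := abs_le.1 (abs_homoclinicLift_le hw d' s)
          linarith [hn s]
        exact_mod_cast this
      · have : (M * n s : ℝ) ≤ (d s : ℕ) + n (s * a) + n (s * b) := by
          rw [hn, hn, hn]
          have h1 := mul_homoclinicLift_greenFunction hM a b d s
          have h2 := mul_homoclinicLift_greenFunction hM a b d' s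
          have h3 : (0 : ℝ) ≤ (d' s : ℕ) := Nat.cast_nonneg _
          linarith
        exact_mod_cast this
    intro d hd d' hd' h
    have heq : homoclinicLift M w d = homoclinicLift M w d' :=
      funext fun s => le_antisymm (hle d d' hd h s) (hle d' d hd' h.symm s)
    funext s
    have h1 := mul_homoclinicLift_greenFunction hM a b d s
    have h2 := mul_homoclinicLift_greenFunction hM a b d' s
    change M * homoclinicLift M w d s = _ + homoclinicLift M w d _ + homoclinicLift M w d _ at h1
    change M * homoclinicLift M w d' s = _ + homoclinicLift M w d' _ + homoclinicLift M w d' _ at h2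
    rw [heq] at h1
    have h3 : ((d s : ℕ) : ℝ) = (d' s : ℕ) := by linarith
    exact Fin.ext (by exact_mod_cast h3)

/-! ### Fourier coefficients of the image measure -/

/-- The product `g · w*` of `g ∈ ℤΓ` with the adjoint of `w ∈ ℓ¹(Γ, ℝ)`. -/
def mulAdjoint (g : MonoidAlgebra ℤ Γ) (w : Γ → ℝ) (t : Γ) : ℝ :=
  g.coeff.sum fun s n => (n : ℝ) * w (t⁻¹ * s)

section mulAdjoint

variable {w : Γ → ℝ} (g : MonoidAlgebra ℤ Γ)

theorem summable_mulAdjoint (hw : Summable w) : Summable (mulAdjoint g w) :=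
  summable_sum fun s _ => (summable_inv_mul hw s).mul_left _

theorem pairing_homoclinicMap {M : ℕ} (hw : Summable w) (d : Γ → Fin M) :
    pairing (homoclinicMap M w d) g =
      ((∑' t, ((d t : ℕ) : ℝ) * mulAdjoint g w t : ℝ) : UnitAddCircle) := by
  have h : ∑' t, ((d t : ℕ) : ℝ) * mulAdjoint g w t
      = ∑ s ∈ g.coeff.support, g.coeff s • ∑' t : Γ, ((d t : ℕ) : ℝ) * w (t⁻¹ * s) := by
    simp only [zsmul_eq_mul, ← tsum_mul_left]
    rw [← Summable.tsum_finsetSum fun s _ =>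
      (summable_digit_mul (summable_inv_mul hw s) d).mul_left _]
    refine tsum_congr fun t => ?_
    rw [mulAdjoint, Finsupp.sum, Finset.mul_sum]
    exact Finset.sum_congr rfl fun s _ => by ring
  rw [h, pairing, Finsupp.sum]
  exact (map_sum (QuotientAddGroup.mk' (AddSubgroup.zmultiples (1 : ℝ))) _ _).symm

/-- With `h = g w*` this is `h f = g`, dual to the equation for the lift. -/
theorem mul_mulAdjoint_greenFunction {M : ℕ} (hM : 3 ≤ M) (a b t : Γ) :
    M * mulAdjoint g (greenFunction M a b) t = g.coeff t
      + mulAdjoint g (greenFunction M a b) (t * a⁻¹)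
      + mulAdjoint g (greenFunction M a b) (t * b⁻¹) := by
  classical
  have h : (g.coeff t : ℝ) = ∑ s ∈ g.coeff.support,
      (g.coeff s : ℝ) * Set.indicator {1} 1 (t⁻¹ * s) := by
    simp only [Set.indicator_apply, Set.mem_singleton_iff, inv_mul_eq_one, Pi.one_apply, mul_ite,
      mul_one, mul_zero, Finset.sum_ite_eq, Finsupp.mem_support_iff]
    split_ifs with h0
    · rfl
    · simpa using h0
  rw [h]
  simp only [mulAdjoint, Finsupp.sum, Finset.mul_sum, ← Finset.sum_add_distrib]
  refine Finset.sum_congr rfl fun s _ => ?_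
  rw [mul_left_comm, mul_greenFunction_left hM]
  simp only [mul_inv_rev, inv_inv, mul_assoc]
  ring

/-- `w*` lives in degrees `≥ 0` and `g` has finite support. The bound makes a least-degree choice
possible. -/
theorem exists_deg_lower_bound {M : ℕ} {a b : Γ} (deg : Γ →* Multiplicative ℤ)
    (ha : deg a = Multiplicative.ofAdd 1) (hb : deg b = Multiplicative.ofAdd 1) :
    ∃ N : ℤ, ∀ t, mulAdjoint g (greenFunction M a b) t ≠ 0 → N ≤ (deg t).toAdd := by
  obtain ⟨N, hN⟩ := (g.coeff.support.image fun s => (deg s).toAdd).bddBelow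
  refine ⟨N, fun t ht => ?_⟩
  obtain ⟨s, hs, h⟩ := Finset.exists_ne_zero_of_sum_ne_zero ht
  have h1 := deg_nonpos_of_greenFunction_ne_zero deg ha hb (right_ne_zero_of_mul h)
  have h2 := hN (Finset.mem_coe.2 (Finset.mem_image_of_mem (fun s => (deg s).toAdd) hs))
  simp only [map_mul, map_inv, toAdd_mul, toAdd_inv] at h1 h2
  linarith

/-- A summable integer-valued `h` has finite support, so `h ∈ ℤΓ` and `g = h f`. -/
theorem mem_span_of_mulAdjoint_integral {M : ℕ} (hM : 3 ≤ M) (a b : Γ)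
    (h : ∀ t, ∃ n : ℤ, (n : ℝ) = mulAdjoint g (greenFunction M a b) t) :
    g ∈ Ideal.span {trinomial M a b} := by
  choose n hn using h
  have hfin : (Function.support n).Finite := by
    have h1 := (summable_mulAdjoint g (summable_greenFunction hM a b)).tendsto_cofinite_zero
    have h2 := h1.eventually (Metric.ball_mem_nhds 0 one_pos)
    refine (Filter.eventually_cofinite.1 h2).subset fun t ht h3 => ht ?_
    rw [Real.dist_eq, sub_zero, ← hn, abs_lt] at h3
    have h4 : (-1 : ℤ) < n t := by exact_mod_cast h3.1
    have h5 : n t < 1 := by exact_mod_cast h3.2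
    omega
  refine Ideal.mem_span_singleton'.2
    ⟨MonoidAlgebra.ofCoeff (Finsupp.ofSupportFinite n hfin), ?_⟩
  rw [← MonoidAlgebra.coeff_inj]
  ext t
  have key := mul_mulAdjoint_greenFunction g hM a b t
  rw [← hn, ← hn, ← hn] at key
  have key' : M * n t = g.coeff t + n (t * a⁻¹) + n (t * b⁻¹) := by exact_mod_cast key
  simp only [trinomial, mul_sub, MonoidAlgebra.coeff_sub, Finsupp.sub_apply,
    MonoidAlgebra.coeff_mul_single_apply, Finsupp.ofSupportFinite_coe,
    inv_one, mul_one]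
  linarith

end mulAdjoint

theorem toCircle_coe_ne_one {x : ℝ} (h : ∀ n : ℤ, (n : ℝ) ≠ x) :
    AddCircle.toCircle (x : UnitAddCircle) ≠ 1 := by
  intro h1
  rw [← AddCircle.toCircle_zero (T := 1)] at h1
  obtain ⟨n, hn⟩ := (AddCircle.coe_eq_zero_iff _).1 (AddCircle.injective_toCircle one_ne_zero h1)
  exact h n (by simpa using hn)

/-- The Fourier coefficients of the image of the Bernoulli measure under the homoclinic map
vanish outside the left ideal generated by `M - a - b`. -/
theorem integral_toCircle_pairing_homoclinicMap {M : ℕ} (hM : 3 ≤ M)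
    (deg : Γ →* Multiplicative ℤ) {a b : Γ} (ha : deg a = Multiplicative.ofAdd 1)
    (hb : deg b = Multiplicative.ofAdd 1) {g : MonoidAlgebra ℤ Γ}
    (hg : g ∉ Ideal.span {trinomial M a b}) :
    ∫ d, (AddCircle.toCircle (pairing (homoclinicMap M (greenFunction M a b) d) g) : ℂ)
      ∂bernoulliMeasure Γ M = 0 := by
  classical
  have : NeZero M := ⟨by omega⟩
  set h := mulAdjoint g (greenFunction M a b) with h_def
  have hsum : Summable h := summable_mulAdjoint g (summable_greenFunction hM a b)
  obtain ⟨t, ht, hmin⟩ : ∃ t, (∀ n : ℤ, (n : ℝ) ≠ h t) ∧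
      ∀ u, (deg u).toAdd < (deg t).toAdd → ∃ n : ℤ, (n : ℝ) = h u := by
    obtain ⟨N, hN⟩ := exists_deg_lower_bound (M := M) g deg ha hb
    have hex : ∃ t, ∀ n : ℤ, (n : ℝ) ≠ h t := by
      by_contra! hcon
      exact hg (mem_span_of_mulAdjoint_integral g hM a b hcon)
    obtain ⟨z, ⟨t, rfl, ht⟩, hz⟩ := Int.exists_least_of_bdd
      (P := fun z => ∃ t, (deg t).toAdd = z ∧ ∀ n : ℤ, (n : ℝ) ≠ h t)
      ⟨N, fun z ⟨t, htz, ht⟩ => htz ▸ hN t fun h0 => ht 0 (by rw [h_def, h0, Int.cast_zero])⟩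
      (let ⟨t, ht⟩ := hex; ⟨_, t, rfl, ht⟩)
    refine ⟨t, ht, fun u hu => ?_⟩
    by_contra! hcon
    exact absurd (hz _ ⟨u, rfl, hcon⟩) (not_le.2 hu)
  -- `t * a⁻¹` and `t * b⁻¹` have smaller degree, so `h` is integral there.
  obtain ⟨m, hm⟩ : ∃ m : ℤ, (m : ℝ) = M * h t := by
    obtain ⟨n₁, hn₁⟩ := hmin (t * a⁻¹) (by simp [ha])
    obtain ⟨n₂, hn₂⟩ := hmin (t * b⁻¹) (by simp [hb])
    refine ⟨g.coeff t + n₁ + n₂, ?_⟩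
    rw [h_def, mul_mulAdjoint_greenFunction g hM]
    push_cast
    rw [hn₁, hn₂]
  have hrot : ∀ d : Γ → Fin M,
      ((∑' u, (((d + Pi.single t 1 : Γ → Fin M) u : ℕ) : ℝ) * h u : ℝ) : UnitAddCircle)
      = ((h t : ℝ) : UnitAddCircle) + ((∑' u, ((d u : ℕ) : ℝ) * h u : ℝ) : UnitAddCircle) := by
    intro d
    have hs := fun d : Γ → Fin M => summable_digit_mul hsum d
    have hdiff : ∑' u, (((d + Pi.single t 1 : Γ → Fin M) u : ℕ) : ℝ) * h u - ∑' u, ((d u : ℕ) : ℝ) * h u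
        = (((d t + 1 : Fin M) : ℕ) - ((d t : ℕ) : ℝ)) * h t := by
      rw [← (hs _).tsum_sub (hs d), tsum_eq_single t]
      · simp [sub_mul]
      · intro u hu
        simp [hu]
    -- `q` records whether the digit wraps to 0; a wrap changes the sum by `M * h t`, an integer.
    obtain ⟨q, hq⟩ : ∃ q : ℤ, (((d t + 1 : Fin M) : ℕ) : ℝ) = (d t : ℕ) + 1 - M * q := by
      refine ⟨(((d t : ℕ) + 1) / M : ℕ), ?_⟩
      have h1 := Nat.div_add_mod ((d t : ℕ) + 1) M
      have h2 : ((d t + 1 : Fin M) : ℕ) = ((d t : ℕ) + 1) % M := by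
        rw [Fin.val_add, Fin.val_one', Nat.add_mod_mod]
      rw [← h2] at h1
      have h3 : ((M : ℝ) * (((d t : ℕ) + 1) / M : ℕ) + ((d t + 1 : Fin M) : ℕ) : ℝ)
        = (d t : ℕ) + 1 := by exact_mod_cast h1
      rw [Int.cast_natCast]
      linarith
    rw [← AddCircle.coe_add, ← sub_eq_zero, ← AddCircle.coe_sub, AddCircle.coe_eq_zero_iff]
    refine ⟨-(q * m), ?_⟩
    rw [zsmul_eq_mul, mul_one]
    push_cast
    rw [hm]
    rw [hq] at hdiff
    linear_combination -hdiff
  simp only [pairing_homoclinicMap g (summable_greenFunction hM a b)]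
  set I := ∫ d, (AddCircle.toCircle ((∑' u, ((d u : ℕ) : ℝ) * h u : ℝ) : UnitAddCircle) : ℂ)
    ∂bernoulliMeasure Γ M
  have hI : I = (AddCircle.toCircle ((h t : ℝ) : UnitAddCircle) : ℂ) * I := by
    have hp := measurePreserving_add_right (Pi.single t 1 : Γ → Fin M)
    have hemb : MeasurableEmbedding fun d : Γ → Fin M => d + Pi.single t 1 :=
      (MeasurableEquiv.addRight (Pi.single t 1 : Γ → Fin M)).measurableEmbedding
    rw [← integral_const_mul]
    refine (hp.integral_comp hemb _).symm.trans (integral_congr_ae (.of_forall fun d => ?_))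
    beta_reduce
    rw [hrot, AddCircle.toCircle_add, Circle.coe_mul]
  have hne : (AddCircle.toCircle ((h t : ℝ) : UnitAddCircle) : ℂ) ≠ 1 := by
    rw [← Circle.coe_one]
    exact fun h1 => toCircle_coe_ne_one ht (Circle.coe_injective h1)
  by_contra h0
  exact hne (mul_right_cancel₀ h0 (by rw [one_mul, ← hI]))

/-! ### Characters determine Haar measure -/

section characters

variable (f : MonoidAlgebra ℤ Γ)

theorem pairing_add_left {ι : Type*} (x y : ι → UnitAddCircle) (g : MonoidAlgebra ℤ ι) :
    pairing (x + y) g = pairing x g + pairing y g := by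
  simp [pairing, Finsupp.sum_add]

theorem pairing_neg (x : Γ → UnitAddCircle) (g : MonoidAlgebra ℤ Γ) :
    pairing x (-g) = -pairing x g :=
  map_neg (AddMonoidHom.mk' (pairing x) (pairing_add x)) g

/-- The character `x ↦ exp (2πi ⟨x, g⟩)` of `X_f`. -/
def character (g : MonoidAlgebra ℤ Γ) : principalGroup f →ᵇ ℂ :=
  BoundedContinuousFunction.mkOfCompact
    ⟨fun x => (AddCircle.toCircle (pairing (x : Γ → UnitAddCircle) g) : ℂ),
      continuous_subtype_val.comp <| AddCircle.continuous_toCircle.comp <|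
        (continuous_pairing g).comp continuous_subtype_val⟩

theorem character_apply (g : MonoidAlgebra ℤ Γ) (x : principalGroup f) :
    character f g x = (AddCircle.toCircle (pairing (x : Γ → UnitAddCircle) g) : ℂ) := rfl

theorem character_zero : character f 0 = 1 := by
  ext x
  simp [character_apply, pairing]

theorem character_add (g h : MonoidAlgebra ℤ Γ) :
    character f (g + h) = character f g * character f h := by
  ext x
  simp [character_apply, pairing_add, AddCircle.toCircle_add]

theorem character_neg (g : MonoidAlgebra ℤ Γ) : character f (-g) = star (character f g) := by
  ext x
  simp only [character_apply, pairing_neg, AddCircle.toCircle_neg, Circle.coe_inv_eq_conj,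
    BoundedContinuousFunction.star_apply, RCLike.star_def]

/-- The trigonometric polynomials on `X_f`. -/
def trigPolynomial : StarSubalgebra ℂ (principalGroup f →ᵇ ℂ) where
  toSubalgebra := (Submodule.span ℂ (Set.range (character f))).toSubalgebra
    (Submodule.subset_span ⟨0, character_zero f⟩) (by
      intro x y hx hy
      have hxy := Submodule.mul_mem_mul hx hy
      rw [Submodule.span_mul_span] at hxy
      refine Submodule.span_mono ?_ hxy
      rintro _ ⟨_, ⟨g, rfl⟩, _, ⟨h, rfl⟩, rfl⟩
      exact ⟨g + h, character_add f g h⟩)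
  star_mem' := by
    intro x hx
    change star x ∈ Submodule.span ℂ (Set.range (character f))
    replace hx : x ∈ Submodule.span ℂ (Set.range (character f)) := hx
    induction hx using Submodule.span_induction with
    | mem x hx =>
      obtain ⟨g, rfl⟩ := hx
      exact Submodule.subset_span ⟨-g, character_neg f g⟩
    | zero => rw [star_zero]; exact zero_mem _
    | add x y _ _ hx hy => rw [star_add]; exact add_mem hx hy
    | smul c x _ hx => rw [star_smul]; exact Submodule.smul_mem _ _ hx

theorem character_mem_trigPolynomial (g : MonoidAlgebra ℤ Γ) :
    character f g ∈ trigPolynomial f :=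
  Submodule.subset_span ⟨g, rfl⟩

theorem separatesPoints_trigPolynomial :
    ((trigPolynomial f).map
      (BoundedContinuousFunction.toContinuousMapStarₐ ℂ)).SeparatesPoints := by
  intro x y hxy
  obtain ⟨s, hs⟩ : ∃ s, (x : Γ → UnitAddCircle) s ≠ (y : Γ → UnitAddCircle) s := by
    by_contra! h
    exact hxy (Subtype.ext (funext h))
  refine ⟨character f (MonoidAlgebra.single s 1),
    ⟨_, ⟨_, character_mem_trigPolynomial f _, rfl⟩, rfl⟩, fun h => hs ?_⟩
  have h' := AddCircle.injective_toCircle one_ne_zero (Circle.coe_injective h)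
  simpa [pairing_single] using h'

variable [Countable Γ]

instance : PolishSpace (principalGroup f) := by
  have : PolishSpace UnitAddCircle := inferInstance
  exact (isClosed_principalGroup f).polishSpace

/-- The characters span a point-separating star subalgebra, which determines finite measures on a
Polish space. -/
theorem ext_of_integral_character {μ ν : Measure (principalGroup f)} [IsFiniteMeasure μ]
    [IsFiniteMeasure ν] (h : ∀ g, ∫ x, character f g x ∂μ = ∫ x, character f g x ∂ν) : μ = ν := by
  refine ext_of_forall_mem_subalgebra_integral_eq_of_polish (separatesPoints_trigPolynomial f)
    fun F hF => ?_
  replace hF : F ∈ Submodule.span ℂ (Set.range (character f)) := hF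
  induction hF using Submodule.span_induction with
  | mem F hF => obtain ⟨g, rfl⟩ := hF; exact h g
  | zero => simp
  | add F G _ _ hF hG =>
    simp only [BoundedContinuousFunction.add_apply]
    rw [integral_add (F.integrable _) (G.integrable _), integral_add (F.integrable _)
      (G.integrable _), hF, hG]
  | smul c F _ hF =>
    simp only [BoundedContinuousFunction.smul_apply, integral_smul, hF]

/-- A probability measure on `X_f` whose nontrivial Fourier coefficients vanish is Haar measure. -/
theorem eq_principalHaar_of_integral_character {μ : Measure (principalGroup f)}
    [IsProbabilityMeasure μ]
    (h : ∀ g, g ∉ Ideal.span {f} → ∫ x, character f g x ∂μ = 0) : μ = principalHaar f := by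
  have hinv : μ.IsAddLeftInvariant := by
    refine ⟨fun c => ?_⟩
    have hc : Measurable fun x : principalGroup f => c + x := measurable_const_add c
    have : IsProbabilityMeasure (μ.map fun x => c + x) :=
      Measure.isProbabilityMeasure_map hc.aemeasurable
    refine ext_of_integral_character f fun g => ?_
    rw [integral_map hc.aemeasurable (character f g).continuous.aestronglyMeasurable]
    -- Inside the ideal the character is constantly 1; outside it, translation multiplies a zero
    -- integral by a constant.
    by_cases hg : g ∈ Ideal.span {f}
    · refine integral_congr_ae (.of_forall fun x => ?_)
      simp only [character_apply, (c + x).2 g hg, x.2 g hg]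
    · have hmul : ∀ x, character f g (c + x) = character f g c * character f g x := fun x => by
        simp only [character_apply, AddSubgroup.coe_add, pairing_add_left, AddCircle.toCircle_add,
          Circle.coe_mul]
      simp only [hmul, integral_const_mul, h g hg, mul_zero]
  have : μ.IsAddHaarMeasure := Measure.isAddHaarMeasure_of_isCompact_nonempty_interior μ Set.univ
    isCompact_univ (by simp) (by simp) (by simp)
  have h1 : IsProbabilityMeasure (principalHaar f) := ⟨Measure.addHaarMeasure_self⟩
  have h2 : (principalHaar f).IsAddHaarMeasure := Measure.isAddHaarMeasure_addHaarMeasure _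
  exact Measure.isAddHaarMeasure_eq_of_isProbabilityMeasure _ _

end characters

/-! ### The inverse map and the isomorphism -/

/-- A measure-preserving map that is injective on a conull set has an inverse modulo null sets. -/
theorem exists_ae_inverse {Y X : Type*} [MeasurableSpace Y] [StandardBorelSpace Y] [Nonempty Y]
    [MeasurableSpace X] [MeasurableSpace.CountablySeparated X] {ν : Measure Y} {μ : Measure X}
    {φ : Y → X} (hφ : MeasurePreserving φ ν μ) {S : Set Y} (hS : MeasurableSet S)
    (hν : ∀ᵐ y ∂ν, y ∈ S) (hinj : Set.InjOn φ S) :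
    ∃ ψ : X → Y, MeasurePreserving ψ μ ν ∧ (∀ᵐ y ∂ν, ψ (φ y) = y) ∧ ∀ᵐ x ∂μ, φ (ψ x) = x := by
  have : StandardBorelSpace S := hS.standardBorel
  -- Lusin–Souslin: an injective measurable map from a standard Borel space is a measurable
  -- embedding.
  have hemb : MeasurableEmbedding fun y : S => φ y :=
    (hφ.measurable.comp measurable_subtype_coe).measurableEmbedding
      fun y z h => Subtype.ext (hinj y.2 z.2 h)
  obtain ⟨ψ, hψ, hψφ⟩ := hemb.exists_measurable_extend measurable_subtype_coe fun _ => ‹Nonempty Y›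
  have hleft : ∀ y ∈ S, ψ (φ y) = y := fun y hy => congrFun hψφ ⟨y, hy⟩
  have hae : ∀ᵐ y ∂ν, ψ (φ y) = y := hν.mono hleft
  refine ⟨ψ, ⟨hψ, ?_⟩, hae, ?_⟩
  · rw [← hφ.map_eq, Measure.map_map hψ hφ.measurable]
    exact (Measure.map_congr hae).trans Measure.map_id
  · have himg : MeasurableSet (φ '' S) := hS.image_of_measurable_injOn hφ.measurable hinj
    have hmem : ∀ᵐ x ∂μ, x ∈ φ '' S := by
      rw [← hφ.map_eq]
      exact (ae_map_iff hφ.measurable.aemeasurable himg).2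
        (hν.mono fun y hy => Set.mem_image_of_mem φ hy)
    filter_upwards [hmem]
    rintro _ ⟨y, hy, rfl⟩
    rw [hleft y hy]

theorem homoclinicMap_shift {M : ℕ} (w : Γ → ℝ) (u : Γ) (d : Γ → Fin M) :
    homoclinicMap M w (shift (Fin M) u d) = shift UnitAddCircle u (homoclinicMap M w d) :=
  funext fun s => congrArg ((↑) : ℝ → UnitAddCircle) (homoclinicLift_shift d u s)

/-- The homoclinic map with values in `X_f`. -/
def homoclinicFactor {M : ℕ} (hM : 3 ≤ M) (a b : Γ) (d : Γ → Fin M) :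
    principalGroup (trinomial M a b) :=
  ⟨homoclinicMap M (greenFunction M a b) d, homoclinicMap_mem hM a b d⟩

theorem measurePreserving_homoclinicFactor [Countable Γ] {M : ℕ} (hM : 3 ≤ M)
    (deg : Γ →* Multiplicative ℤ) {a b : Γ} (ha : deg a = Multiplicative.ofAdd 1)
    (hb : deg b = Multiplicative.ofAdd 1) :
    MeasurePreserving (homoclinicFactor hM a b) (bernoulliMeasure Γ M)
      (principalHaar (trinomial M a b)) := by
  have : NeZero M := ⟨by omega⟩
  have hmeas : Measurable (homoclinicFactor hM a b) :=
    ((continuous_homoclinicMap (summable_greenFunction hM a b)).subtype_mk _).measurable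
  have : IsProbabilityMeasure ((bernoulliMeasure Γ M).map (homoclinicFactor hM a b)) :=
    Measure.isProbabilityMeasure_map hmeas.aemeasurable
  refine ⟨hmeas, eq_principalHaar_of_integral_character _ fun g hg => ?_⟩
  rw [integral_map hmeas.aemeasurable (character _ g).continuous.aestronglyMeasurable]
  exact integral_toCircle_pairing_homoclinicMap hM deg ha hb hg

end PrincipalAction

end

theorem theorem7p1 {Γ : Type*} [Group Γ] [Countable Γ] (deg : Γ →* Multiplicative ℤ)
    (a b : Γ) (hab : a ≠ b) (ha : deg a = Multiplicative.ofAdd 1)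
    (hb : deg b = Multiplicative.ofAdd 1) (M : ℕ) (hM : 3 ≤ M)
    (f : MonoidAlgebra ℤ Γ)
    (hf : f = MonoidAlgebra.single 1 (M : ℤ) - MonoidAlgebra.single a 1 - MonoidAlgebra.single b 1) :
    ∃ w : Γ → ℝ, PrincipalAction.IsSummableInverse (PrincipalAction.involution f) w ∧
      ∃ φ : (Γ → Fin M) → PrincipalAction.principalGroup f,
        (∀ d, (φ d : Γ → UnitAddCircle) = PrincipalAction.homoclinicMap M w d) ∧
        PrincipalAction.IsMeasurableIsomorphism
          (PrincipalAction.bernoulliMeasure Γ M) (fun s => PrincipalAction.shift (Fin M) s)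
          (PrincipalAction.principalHaar f) (fun s => PrincipalAction.principalAction f s) φ := by
  have : NeZero M := ⟨by omega⟩
  obtain rfl : f = PrincipalAction.trinomial M a b := hf
  have hφ := PrincipalAction.measurePreserving_homoclinicFactor hM deg ha hb
  obtain ⟨S, hS, hν, hinj⟩ :=
    PrincipalAction.exists_measurableSet_injOn_homoclinicMap hM deg ha hb
  exact ⟨PrincipalAction.greenFunction M a b,
    PrincipalAction.isSummableInverse_greenFunction hM a b,
    PrincipalAction.homoclinicFactor hM a b, fun _ => rfl, hφ,
    fun s => .of_forall fun d => Subtype.ext (PrincipalAction.homoclinicMap_shift _ s d),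
    PrincipalAction.exists_ae_inverse hφ hS hν fun d hd d' hd' h =>
      hinj hd hd' (congrArg Subtype.val h)⟩
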